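/- Let $g(t)=2^{1/4}e^{-\pi t^2}$ and, for $u,v\in\mathbb{R}$, let $M_vT_ug(t)=e^{2\pi i v t}g(t-u)$. For a tempered distribution $f\in\mathcal{S}'(\mathbb{R})$ let $V_gf(u,v)=\langle f,M_vT_ug\rangle$, where $\langle f,\phi\rangle=f(\phi)$ is the bilinear action of $f$ on Schwartz functions $\phi$, and define the Gabor transform (normalized by the factor $\sqrt{\pi}$) $$F[f](z)=\sqrt{\pi}\,V_gf(u,v),\qquad z=u+iv\in\mathbb{C}.$$ The white noise measure $\mu_1$ is the Borel probability measure on $\mathcal{S}'(\mathbb{R})$ under which $\langle\cdot,\phi\rangle$ is almost surely real for every real-valued Schwartz function $\phi$ and $$\int_{\mathcal{S}'(\mathbb{R})} e^{i\langle\xi,\phi\rangle}\,d\mu_1(\xi)=e^{-\frac12\|\phi\|_{L^2(\mathbb{R})}^2}\qquad\text{for every real-valued Schwartz function }\phi.$$ For $L>0$ let $\mathbb{B}_L=\{u+iv\in\mathbb{C}:\ \max\{|u|,|v|\}\le L\}$. Theorem. There is a universal constant $K>0$ such that for every random variable $\xi$ with distribution $\mu_1$, every $L\ge\pi$ and every $\tau>0$,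 $$\mathbb{P}\Big[\sup_{z\in\mathbb{B}_L}|F[\xi](z)|\le\sqrt2\,(14K+\tau)\sqrt{\log L}\Big]\ \ge\ 1-4\exp\Big(-\frac{\tau^2}{2\pi}\log L\Big).$$ -/

import Mathlib

open MeasureTheory ProbabilityTheory
open scoped SchwartzMap

noncomputable section

namespace GaborNoise

/-- The real Gaussian `2^{1/4} e^{-π t²}`, of unit norm in `L²(ℝ)`. -/
def gaussian (t : ℝ) : ℝ := (2 : ℝ) ^ (1 / 4 : ℝ) * Real.exp (-Real.pi * t ^ 2)

theorem contDiff_ofReal_gaussian : ContDiff ℝ (⊤ : ℕ∞) (fun t : ℝ => (gaussian t : ℂ)) := by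
  refine Complex.ofRealCLM.contDiff.comp ?_
  change ContDiff ℝ (⊤ : ℕ∞) (fun t : ℝ => (2 : ℝ) ^ (1 / 4 : ℝ) * Real.exp (-Real.pi * t ^ 2))
  fun_prop

theorem iteratedDeriv_gaussian (n : ℕ) : ∃ p : Polynomial ℝ,
    iteratedDeriv n (fun t : ℝ => (gaussian t : ℂ)) =
      fun t : ℝ => ((p.eval t * Real.exp (-Real.pi * t ^ 2) : ℝ) : ℂ) := by
  induction n with
  | zero => exact ⟨Polynomial.C ((2 : ℝ) ^ (1 / 4 : ℝ)), by simp [gaussian]⟩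
  | succ n ih =>
    obtain ⟨p, hp⟩ := ih
    refine ⟨p.derivative + Polynomial.C (-2 * Real.pi) * Polynomial.X * p, ?_⟩
    rw [iteratedDeriv_succ, hp]
    funext t
    have h1 : HasDerivAt (fun t : ℝ => -Real.pi * t ^ 2) (-Real.pi * (2 * t)) t := by
      simpa using (hasDerivAt_pow 2 t).const_mul (-Real.pi)
    have h2 := ((p.hasDerivAt t).mul h1.exp).ofReal_comp
    refine h2.deriv.trans ?_
    congr 1
    simp
    ring

theorem decay_polynomial_gaussian (k : ℕ) (p : Polynomial ℝ) : ∃ C : ℝ, ∀ t : ℝ,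
    |t| ^ k * |p.eval t * Real.exp (-Real.pi * t ^ 2)| ≤ C := by
  have hmono : ∀ m : ℕ, ∃ C : ℝ, ∀ t : ℝ, |t| ^ m * Real.exp (-Real.pi * t ^ 2) ≤ C := by
    intro m
    refine ⟨1 + m.factorial, fun t => ?_⟩
    have hE : Real.exp (-Real.pi * t ^ 2) ≤ Real.exp (-(t ^ 2)) := by
      apply Real.exp_le_exp.2
      nlinarith [Real.pi_gt_three, sq_nonneg t]
    have hE1 : Real.exp (-(t ^ 2)) ≤ 1 := Real.exp_le_one_iff.2 (by nlinarith [sq_nonneg t])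
    have h0 : (0 : ℝ) ≤ |t| ^ m := by positivity
    have h1 : |t| ^ m ≤ 1 + (t ^ 2) ^ m := by
      rw [← sq_abs t, ← pow_mul, mul_comm 2 m, pow_mul]
      nlinarith [sq_nonneg (|t| ^ m - 1), h0]
    have h2 : (t ^ 2) ^ m ≤ m.factorial * Real.exp (t ^ 2) := by
      have := Real.pow_div_factorial_le_exp (t ^ 2) (sq_nonneg t) m
      rwa [div_le_iff₀ (by positivity), mul_comm] at this
    calc |t| ^ m * Real.exp (-Real.pi * t ^ 2)
        ≤ (1 + m.factorial * Real.exp (t ^ 2)) * Real.exp (-(t ^ 2)) := by gcongr; linarith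
      _ = Real.exp (-(t ^ 2)) + m.factorial * (Real.exp (t ^ 2) * Real.exp (-(t ^ 2))) := by ring
      _ ≤ 1 + m.factorial := by rw [← Real.exp_add]; simpa using hE1
  induction p using Polynomial.induction_on' with
  | add p q hp hq =>
    obtain ⟨C, hC⟩ := hp
    obtain ⟨D, hD⟩ := hq
    refine ⟨C + D, fun t => ?_⟩
    rw [Polynomial.eval_add, add_mul]
    refine le_trans ?_ (add_le_add (hC t) (hD t))
    rw [← mul_add]
    gcongr
    exact abs_add_le _ _
  | monomial n a =>
    obtain ⟨C, hC⟩ := hmono (k + n)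
    refine ⟨|a| * C, fun t => ?_⟩
    rw [Polynomial.eval_monomial, abs_mul, abs_mul, abs_pow, Real.abs_exp]
    calc |t| ^ k * (|a| * |t| ^ n * Real.exp (-Real.pi * t ^ 2))
        = |a| * (|t| ^ (k + n) * Real.exp (-Real.pi * t ^ 2)) := by ring
      _ ≤ |a| * C := by gcongr; exact hC t

/-- The Gaussian window `g(t) = 2^{1/4} e^{-π t²}`, as a Schwartz function. -/
def gaussianWindow : 𝓢(ℝ, ℂ) where
  toFun t := (gaussian t : ℂ)
  smooth' := contDiff_ofReal_gaussian
  decay' k n := by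
    obtain ⟨p, hp⟩ := iteratedDeriv_gaussian n
    obtain ⟨C, hC⟩ := decay_polynomial_gaussian k p
    refine ⟨C, fun t => ?_⟩
    rw [norm_iteratedFDeriv_eq_norm_iteratedDeriv, hp, Complex.norm_real]
    exact hC t

theorem gaussianWindow_apply (t : ℝ) :
    gaussianWindow t = (((2 : ℝ) ^ (1 / 4 : ℝ) * Real.exp (-Real.pi * t ^ 2) : ℝ) : ℂ) := rfl

/-- The character `t ↦ e^{2π i v t}`. -/
def character (v t : ℝ) : ℂ := Complex.exp (2 * Real.pi * Complex.I * v * t)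

theorem iteratedDeriv_character (v : ℝ) (n : ℕ) :
    iteratedDeriv n (character v) =
      fun t => (2 * Real.pi * Complex.I * v) ^ n * character v t := by
  induction n with
  | zero => simp
  | succ n ih =>
    rw [iteratedDeriv_succ, ih]
    funext t
    have h1 : HasDerivAt (fun t : ℝ => 2 * Real.pi * Complex.I * v * (t : ℂ))
        (2 * Real.pi * Complex.I * v) t := by
      simpa using (Complex.ofRealCLM.hasDerivAt (x := t)).const_mul (2 * Real.pi * Complex.I * v)
    refine (h1.cexp.const_mul _).deriv.trans ?_
    simp only [character]
    ring

theorem norm_character (v t : ℝ) : ‖character v t‖ = 1 := by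
  have : character v t = Complex.exp ((2 * Real.pi * v * t : ℝ) * Complex.I) := by
    unfold character
    congr 1
    push_cast
    ring
  rw [this, Complex.norm_exp_ofReal_mul_I]

theorem hasTemperateGrowth_character (v : ℝ) : (character v).HasTemperateGrowth := by
  refine ⟨?_, fun n => ⟨0, ‖(2 * Real.pi * Complex.I * v : ℂ) ^ n‖, fun t => ?_⟩⟩
  · refine ContDiff.cexp ?_
    exact contDiff_const.mul Complex.ofRealCLM.contDiff
  · rw [norm_iteratedFDeriv_eq_norm_iteratedDeriv, iteratedDeriv_character, norm_mul,
      norm_character]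
    simp

/-- Translation `T_u φ = φ(· - u)` on Schwartz functions. -/
def translation (u : ℝ) : 𝓢(ℝ, ℂ) →L[ℂ] 𝓢(ℝ, ℂ) := SchwartzMap.compSubConstCLM ℂ u

theorem translation_apply (u : ℝ) (φ : 𝓢(ℝ, ℂ)) (t : ℝ) :
    translation u φ t = φ (t - u) := rfl

/-- Modulation `M_v φ = e^{2π i v ·} φ` on Schwartz functions. -/
def modulation (v : ℝ) : 𝓢(ℝ, ℂ) →L[ℂ] 𝓢(ℝ, ℂ) := SchwartzMap.smulLeftCLM ℂ (character v)

theorem modulation_apply (v : ℝ) (φ : 𝓢(ℝ, ℂ)) (t : ℝ) :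
    modulation v φ t = Complex.exp (2 * Real.pi * Complex.I * v * t) * φ t :=
  SchwartzMap.smulLeftCLM_apply_apply (hasTemperateGrowth_character v) φ t

/-- The short-time Fourier transform `V_φ f(u, v) = ⟨f, M_v T_u φ⟩` of a tempered distribution `f`
with a Schwartz window `φ`; here `⟨f, ψ⟩ = f(ψ)` is the (bilinear) action of `f` on `ψ`. -/
def stft (φ : 𝓢(ℝ, ℂ)) (f : 𝓢'(ℝ, ℂ)) (u v : ℝ) : ℂ := f (modulation v (translation u φ))

/-- The Gabor transform `F[f](u + iv) = √π · V_g f(u, v)`. The factor `√π` is the normalization for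
which `F[f](z) = √π exp(iπuv - π|z|²/2) ∑ₖ ⟨f, hₖ⟩ π^{k/2} zᵏ / √(k!)`, `hₖ` being the Hermite
functions; for Gaussian white noise `ξ` it gives `E|F[ξ](z)|² = π`. -/
def gaborTransform (f : 𝓢'(ℝ, ℂ)) (z : ℂ) : ℂ :=
  (Real.sqrt Real.pi : ℂ) * stft gaussianWindow f z.re z.im

/-- The square `B_L = {u + iv : max(|u|, |v|) ≤ L}`. -/
def square (L : ℝ) : Set ℂ := {z | max |z.re| |z.im| ≤ L}

/-- The Borel `σ`-algebra on the space of tempered distributions (with the topology of pointwise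
convergence). -/
instance : MeasurableSpace (𝓢'(ℝ, ℂ)) := borel _

instance : BorelSpace (𝓢'(ℝ, ℂ)) := ⟨rfl⟩

/-- The white noise measure: the Borel probability measure on the tempered distributions that is
carried by the real ones (real-valued on real-valued test functions) and has the characteristic
functional `∫ e^{i⟨ξ, φ⟩} dμ(ξ) = e^{-‖φ‖²/2}` on real-valued Schwartz functions `φ`, where `‖φ‖` is
the norm of `L²(ℝ)`. -/
structure IsWhiteNoiseMeasure (μ : Measure (𝓢'(ℝ, ℂ))) : Prop where
  isProbabilityMeasure : IsProbabilityMeasure μ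
  real_valued : ∀ φ : 𝓢(ℝ, ℂ), (∀ t, (φ t).im = 0) → ∀ᵐ ξ ∂μ, (ξ φ).im = 0
  charFun_eq : ∀ φ : 𝓢(ℝ, ℂ), (∀ t, (φ t).im = 0) →
    ∫ ξ, Complex.exp (Complex.I * ξ φ) ∂μ = (Real.exp (-(∫ t, ‖φ t‖ ^ 2) / 2) : ℂ)

end GaborNoise

end

/-!
The supremum of the Gabor transform `F = F[ξ]` is controlled by an integral of `exp (c |F|²)` over a
slightly larger square, and the expectation of that integral is at most twice the area;
Markov's inequality then gives the tail estimate.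

* `F` is entire up to a nonvanishing factor: `e^{πu²} M_v T_u g (t) = g(t) e^{2πzt}` is a power
  series in `z` which converges in the Schwartz topology (`hasSum_gaussianAtom`), so that
  `e^{πu²} F[f](z)` is an entire function of `z` for every tempered distribution `f` (`differentiable_gaborEntire`).
  Up to an exponential of a linear function its modulus is `|F(z)| e^{π(u-u₀)²}`, hence
  `exp (lam |F(z₀)|²)` is at most the mean of `exp (lam e^{2πr²} |F|²)` over the disc of radius `r`
  around `z₀` (`area_mul_exp_gaborTransform_le`).
* Under white noise `|F(z)|² = π (X² + Y²)` for centred Gaussian variables `X`, `Y` whose variances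
  add up to `1`, hence `E exp (3/8 (X² + Y²)) ≤ 2`
  (`IsWhiteNoiseMeasure.lintegral_exp_gaborTransform_le`).

For `r = 1/5` and `lam = 1/(4π)` the two exponents match, because `e^{2π/25} ≤ 3/2`. Thus
`P (sup |F| > s)` is at most a constant times `L² e^{-s²/(4π)}`. With `s² = 2 (14 K + τ)² log L` the
exponential is at most `exp (-(14 K)² log L / (2π)) exp (-τ² log L / (2π))`, and already for `K = 1`
its first factor absorbs `L²`. Neither a chaining argument nor Gaussian concentration is needed: the
passage from `|F|` to its real and imaginary parts leaves a factor `2` of room in the exponent.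
-/

namespace GaborNoise

/-! ### Absolutely convergent series of Schwartz functions -/

theorem schwartz_hasSum_of_summable_seminorm {φ : ℕ → 𝓢(ℝ, ℂ)} {ψ : 𝓢(ℝ, ℂ)}
    (hφ : ∀ k m, Summable fun n => SchwartzMap.seminorm ℂ k m (φ n))
    (hψ : ∀ t, HasSum (fun n => φ n t) (ψ t)) :
    HasSum φ ψ := by
  refine ((schwartz_withSeminorms ℂ ℝ ℂ).tendsto_nhds _ _).2 ?_
  rintro ⟨k, m⟩ ε hε
  have htail := tendsto_tsum_compl_atTop_zero fun n => SchwartzMap.seminorm ℂ k m (φ n)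
  filter_upwards [htail.eventually (gt_mem_nhds hε)] with s hs
  refine lt_of_le_of_lt ?_ hs
  change SchwartzMap.seminorm ℂ k m (∑ n ∈ s, φ n - ψ) ≤ _
  rw [map_sub_rev]
  refine SchwartzMap.seminorm_le_bound ℂ k m _ (tsum_nonneg fun _ => apply_nonneg _ _) fun t => ?_
  have hfun : (⇑(ψ - ∑ n ∈ s, φ n) : ℝ → ℂ) = fun t => ∑' n : { n // n ∉ s }, φ n t := by
    ext t
    rw [sub_apply, sum_apply, sub_eq_iff_eq_add', ← (hψ t).tsum_eq,
      (hψ t).summable.sum_add_tsum_subtype_compl s]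
  have hder : iteratedFDeriv ℝ m (⇑(ψ - ∑ n ∈ s, φ n)) t =
      ∑' n : { n // n ∉ s }, iteratedFDeriv ℝ m (φ n) t := by
    rw [hfun]
    exact iteratedFDeriv_tsum_apply (N := ⊤)
      (v := fun m (n : { n // n ∉ s }) => SchwartzMap.seminorm ℂ 0 m (φ n))
      (fun n => (φ n).smooth _) (fun m _ => (hφ 0 m).subtype _)
      (fun m n t _ => SchwartzMap.norm_iteratedFDeriv_le_seminorm ℂ (φ n) m t) le_top t
  have hs1 : Summable fun n : { n // n ∉ s } => ‖iteratedFDeriv ℝ m (φ n) t‖ :=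
    Summable.of_nonneg_of_le (fun _ => norm_nonneg _)
      (fun n => SchwartzMap.norm_iteratedFDeriv_le_seminorm ℂ (φ n) m t) ((hφ 0 m).subtype _)
  rw [hder]
  calc ‖t‖ ^ k * ‖∑' n : { n // n ∉ s }, iteratedFDeriv ℝ m (φ n) t‖
      ≤ ‖t‖ ^ k * ∑' n : { n // n ∉ s }, ‖iteratedFDeriv ℝ m (φ n) t‖ := by
        gcongr; exact norm_tsum_le_tsum_norm hs1
    _ = ∑' n : { n // n ∉ s }, ‖t‖ ^ k * ‖iteratedFDeriv ℝ m (φ n) t‖ := by rw [tsum_mul_left]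
    _ ≤ _ := by
        refine (hs1.mul_left _).tsum_le_tsum (fun n => ?_) ((hφ k m).subtype _)
        exact SchwartzMap.le_seminorm ℂ k m (φ n) t

/-! ### Entire dependence of the Gabor transform on the point of the plane -/

theorem hasTemperateGrowth_ofReal_pow (n : ℕ) :
    (fun t : ℝ => (t : ℂ) ^ n).HasTemperateGrowth := by
  have : (fun t : ℝ => (t : ℂ)).HasTemperateGrowth := Complex.ofRealCLM.hasTemperateGrowth
  exact this.fun_pow n

/-- The Schwartz function `t ↦ tⁿ g(t)`, where `g` is the Gaussian window. -/
noncomputable def gaussianMonomial (n : ℕ) : 𝓢(ℝ, ℂ) :=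
  SchwartzMap.smulLeftCLM ℂ (fun t : ℝ => (t : ℂ) ^ n) gaussianWindow

theorem gaussianMonomial_apply (n : ℕ) (t : ℝ) :
    gaussianMonomial n t = (t : ℂ) ^ n * gaussianWindow t :=
  SchwartzMap.smulLeftCLM_apply_apply (hasTemperateGrowth_ofReal_pow n) gaussianWindow t

theorem hasDerivAt_gaussianWindow (t : ℝ) :
    HasDerivAt gaussianWindow (-(2 * Real.pi * t) * gaussianWindow t) t := by
  have h1 : HasDerivAt (fun t : ℝ => -Real.pi * t ^ 2) (-Real.pi * (2 * t)) t := by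
    simpa using (hasDerivAt_pow 2 t).const_mul (-Real.pi)
  refine (h1.exp.const_mul ((2 : ℝ) ^ (1 / 4 : ℝ))).ofReal_comp.congr_deriv ?_
  rw [gaussianWindow_apply]
  push_cast
  ring

theorem derivCLM_gaussianMonomial (n : ℕ) :
    SchwartzMap.derivCLM ℂ ℂ (gaussianMonomial n) =
      (n : ℂ) • gaussianMonomial (n - 1) - (2 * Real.pi : ℂ) • gaussianMonomial (n + 1) := by
  ext t
  have h0 : HasDerivAt (fun t : ℝ => (t : ℂ) ^ n) (n * (t : ℂ) ^ (n - 1)) t := by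
    simpa using (hasDerivAt_pow n (t : ℂ)).comp_ofReal
  have h1 := h0.mul (hasDerivAt_gaussianWindow t)
  have h2 : (gaussianMonomial n : ℝ → ℂ) = fun t : ℝ => (t : ℂ) ^ n * gaussianWindow t :=
    funext (gaussianMonomial_apply n)
  rw [SchwartzMap.derivCLM_apply, h2]
  refine h1.deriv.trans ?_
  simp only [sub_apply, smul_apply, gaussianMonomial_apply, smul_eq_mul]
  ring

theorem seminorm_gaussianMonomial_succ_le (k m n : ℕ) :
    SchwartzMap.seminorm ℂ k (m + 1) (gaussianMonomial n) ≤
      n * SchwartzMap.seminorm ℂ k m (gaussianMonomial (n - 1)) +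
        2 * Real.pi * SchwartzMap.seminorm ℂ k m (gaussianMonomial (n + 1)) := by
  have h1 : SchwartzMap.seminorm ℂ k (m + 1) (gaussianMonomial n) ≤
      SchwartzMap.seminorm ℂ k m (SchwartzMap.derivCLM ℂ ℂ (gaussianMonomial n)) := by
    refine SchwartzMap.seminorm_le_bound' ℂ k (m + 1) _ (apply_nonneg _ _) fun t => ?_
    rw [iteratedDeriv_succ']
    exact SchwartzMap.le_seminorm' ℂ k m (SchwartzMap.derivCLM ℂ ℂ (gaussianMonomial n)) t
  refine h1.trans ?_
  rw [derivCLM_gaussianMonomial]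
  refine (map_sub_le_add _ _ _).trans (le_of_eq ?_)
  rw [map_smul_eq_mul, map_smul_eq_mul]
  simp [abs_of_pos Real.pi_pos]

/-- The seminorms of `tⁿ g` grow more slowly than `n! / Rⁿ` for every `R`. The induction is on the
number of derivatives, for all `R` at once: raising the degree of the monomial by one costs a
factor `n + 1`, which is absorbed by passing from `R` to `2 R`. -/
theorem summable_seminorm_gaussianMonomial (k m : ℕ) {R : ℝ} (hR : 1 ≤ R) :
    Summable fun n : ℕ =>
      R ^ n / n.factorial * SchwartzMap.seminorm ℂ k m (gaussianMonomial n) := by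
  induction m generalizing R with
  | zero =>
    have hbound : ∃ C : ℝ, 0 ≤ C ∧
        ∀ t : ℝ, |t| ^ k * Real.exp (2 * R * |t|) * ‖gaussianWindow t‖ ≤ C := by
      refine ⟨k.factorial * (2 : ℝ) ^ (1 / 4 : ℝ) * Real.exp ((2 * R + 1) ^ 2), by positivity,
        fun t => ?_⟩
      have h1 : |t| ^ k ≤ k.factorial * Real.exp |t| := by
        have := Real.pow_div_factorial_le_exp |t| (abs_nonneg t) k
        rwa [div_le_iff₀ (by positivity), mul_comm] at this
      have h2 : |t| + 2 * R * |t| + -Real.pi * t ^ 2 ≤ (2 * R + 1) ^ 2 := by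
        nlinarith [Real.pi_gt_three, sq_abs t, sq_nonneg (2 * R + 1 - |t|), sq_nonneg t]
      have h3 : ‖gaussianWindow t‖ = (2 : ℝ) ^ (1 / 4 : ℝ) * Real.exp (-Real.pi * t ^ 2) := by
        rw [gaussianWindow_apply, Complex.norm_real, Real.norm_of_nonneg (by positivity)]
      calc |t| ^ k * Real.exp (2 * R * |t|) * ‖gaussianWindow t‖
          ≤ k.factorial * Real.exp |t| * Real.exp (2 * R * |t|) *
            ((2 : ℝ) ^ (1 / 4 : ℝ) * Real.exp (-Real.pi * t ^ 2)) := by rw [h3]; gcongr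
        _ = k.factorial * (2 : ℝ) ^ (1 / 4 : ℝ) *
            Real.exp (|t| + 2 * R * |t| + -Real.pi * t ^ 2) := by
            rw [Real.exp_add, Real.exp_add]; ring
        _ ≤ _ := by gcongr
    obtain ⟨C, hC0, hC⟩ := hbound
    refine Summable.of_nonneg_of_le (fun n => by positivity) (fun n => ?_)
      ((summable_geometric_two).mul_right C)
    have hle : SchwartzMap.seminorm ℂ k 0 (gaussianMonomial n) ≤
        (n.factorial / R ^ n) * ((1 / 2) ^ n * C) := by
      refine SchwartzMap.seminorm_le_bound' ℂ k 0 _ (by positivity) fun t => ?_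
      have h1 := Real.pow_div_factorial_le_exp (2 * R * |t|) (by positivity) n
      rw [iteratedDeriv_zero, gaussianMonomial_apply, norm_mul, norm_pow, Complex.norm_real,
        Real.norm_eq_abs]
      have h2 : |t| ^ n = (n.factorial / R ^ n) * ((1 / 2) ^ n *
          ((2 * R * |t|) ^ n / n.factorial)) := by
        rw [mul_pow, mul_pow, one_div, inv_pow]; field_simp
      calc |t| ^ k * (|t| ^ n * ‖gaussianWindow t‖)
          = (n.factorial / R ^ n) * ((1 / 2) ^ n * (|t| ^ k *
            ((2 * R * |t|) ^ n / n.factorial) * ‖gaussianWindow t‖)) := by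
            rw [h2]; ring
        _ ≤ (n.factorial / R ^ n) * ((1 / 2) ^ n *
            (|t| ^ k * Real.exp (2 * R * |t|) * ‖gaussianWindow t‖)) := by gcongr
        _ ≤ _ := by gcongr; exact hC t
    calc R ^ n / n.factorial * SchwartzMap.seminorm ℂ k 0 (gaussianMonomial n)
        ≤ R ^ n / n.factorial * ((n.factorial / R ^ n) * ((1 / 2) ^ n * C)) := by gcongr
      _ = (1 / 2) ^ n * C := by field_simp
  | succ m ih =>
    have hlow : Summable fun n : ℕ => R ^ n / n.factorial *
        (n * SchwartzMap.seminorm ℂ k m (gaussianMonomial (n - 1))) := by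
      rw [← summable_nat_add_iff 1]
      refine ((ih hR).mul_left R).congr fun n => ?_
      rw [Nat.factorial_succ, Nat.add_sub_cancel]
      push_cast
      field_simp
      ring
    have hhigh : Summable fun n : ℕ => (2 * R) ^ (n + 1) / (n + 1).factorial *
        SchwartzMap.seminorm ℂ k m (gaussianMonomial (n + 1)) :=
      (summable_nat_add_iff 1).2 (ih (by linarith : 1 ≤ 2 * R))
    refine Summable.of_nonneg_of_le (fun n => by positivity) (fun n => ?_)
      (hlow.add (hhigh.mul_left (2 * Real.pi)))
    have hpow : R ^ n / n.factorial ≤ (2 * R) ^ (n + 1) / (n + 1).factorial := by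
      have h1 : ((n : ℝ) + 1) ≤ 2 ^ (n + 1) := by exact_mod_cast (Nat.lt_two_pow_self).le
      have h2 : R ^ n ≤ R ^ (n + 1) := pow_le_pow_right₀ hR n.le_succ
      rw [Nat.factorial_succ, div_le_div_iff₀ (by positivity) (by positivity), mul_pow]
      push_cast
      calc R ^ n * ((n + 1) * n.factorial) = ((n + 1) * R ^ n) * n.factorial := by ring
        _ ≤ (2 ^ (n + 1) * R ^ (n + 1)) * n.factorial := by gcongr
    calc R ^ n / n.factorial * SchwartzMap.seminorm ℂ k (m + 1) (gaussianMonomial n)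
        ≤ R ^ n / n.factorial * (n * SchwartzMap.seminorm ℂ k m (gaussianMonomial (n - 1)) +
          2 * Real.pi * SchwartzMap.seminorm ℂ k m (gaussianMonomial (n + 1))) := by
          gcongr; exact seminorm_gaussianMonomial_succ_le k m n
      _ = R ^ n / n.factorial * (n * SchwartzMap.seminorm ℂ k m (gaussianMonomial (n - 1))) +
          2 * Real.pi * (R ^ n / n.factorial *
            SchwartzMap.seminorm ℂ k m (gaussianMonomial (n + 1))) := by ring
      _ ≤ _ := by gcongr

/-- The time-frequency shifted Gaussian `M_v T_u g`, where `z = u + iv`. -/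
noncomputable def gaussianAtom (z : ℂ) : 𝓢(ℝ, ℂ) :=
  modulation z.im (translation z.re gaussianWindow)

theorem gaussianAtom_apply (z : ℂ) (t : ℝ) :
    gaussianAtom z t = Complex.exp (2 * Real.pi * Complex.I * z.im * t) * gaussian (t - z.re) := by
  rw [gaussianAtom, modulation_apply, translation_apply]; rfl

/-- Up to the factor `e^{-πu²}`, the atom is the power series `∑ (2πz)ⁿ tⁿ g(t) / n!`, convergent in
the Schwartz topology. -/
theorem hasSum_gaussianAtom (z : ℂ) :
    HasSum (fun n : ℕ => ((2 * Real.pi * z) ^ n / n.factorial : ℂ) • gaussianMonomial n)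
      ((Real.exp (Real.pi * z.re ^ 2) : ℂ) • gaussianAtom z) := by
  refine schwartz_hasSum_of_summable_seminorm (fun k m => ?_) fun t => ?_
  · refine Summable.of_nonneg_of_le (fun n => apply_nonneg _ _) (fun n => ?_)
      (summable_seminorm_gaussianMonomial k m (R := 2 * Real.pi * ‖z‖ + 1) (by
        have := Real.pi_pos; linarith [show 0 ≤ 2 * Real.pi * ‖z‖ by positivity]))
    rw [map_smul_eq_mul, norm_div, norm_pow, norm_mul]
    have : ‖(2 * Real.pi : ℂ)‖ = 2 * Real.pi := by simp [abs_of_pos Real.pi_pos]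
    rw [this, Complex.norm_natCast]
    gcongr
    linarith
  · have h1 := (NormedSpace.expSeries_div_hasSum_exp (2 * Real.pi * z * t : ℂ)).mul_right
      (gaussianWindow t)
    rw [← Complex.exp_eq_exp_ℂ] at h1
    have hterm : (fun n : ℕ => (((2 * Real.pi * z) ^ n / n.factorial : ℂ) •
        gaussianMonomial n) t) =
        fun n : ℕ => (2 * Real.pi * z * t : ℂ) ^ n / n.factorial * gaussianWindow t := by
      ext n
      rw [smul_apply, gaussianMonomial_apply, smul_eq_mul]
      ring
    have hval : ((Real.exp (Real.pi * z.re ^ 2) : ℂ) • gaussianAtom z) t =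
        Complex.exp (2 * Real.pi * z * t) * gaussianWindow t := by
      rw [smul_apply, gaussianAtom_apply, gaussianWindow_apply, gaussian, smul_eq_mul]
      push_cast
      have h2 : ∀ a b c d : ℂ, Complex.exp a * (Complex.exp b * (c * Complex.exp d)) =
          c * Complex.exp (a + b + d) := by
        intro a b c d; rw [Complex.exp_add, Complex.exp_add]; ring
      have h3 : ∀ a c d : ℂ, Complex.exp a * (c * Complex.exp d) = c * Complex.exp (a + d) := by
        intro a c d; rw [Complex.exp_add]; ring
      rw [h2, h3]
      congr 2
      conv_rhs => rw [← Complex.re_add_im z]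
      ring
    rw [hterm, hval]
    exact h1

/-- The entire function `z ↦ e^{πu²} F[f](z)`, where `z = u + iv`. -/
noncomputable def gaborEntire (f : 𝓢'(ℝ, ℂ)) (z : ℂ) : ℂ :=
  (Real.exp (Real.pi * z.re ^ 2) : ℂ) * gaborTransform f z

theorem differentiable_gaborEntire (f : 𝓢'(ℝ, ℂ)) : Differentiable ℂ (gaborEntire f) := by
  have hsum : ∀ z, HasSum (fun n : ℕ => (Real.sqrt Real.pi : ℂ) *
      ((2 * Real.pi * z) ^ n / n.factorial * f (gaussianMonomial n))) (gaborEntire f z) := by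
    intro z
    have h1 := ((hasSum_gaussianAtom z).map f (map_continuous f)).mul_left (Real.sqrt Real.pi : ℂ)
    have h2 : gaborEntire f z = (Real.sqrt Real.pi : ℂ) *
        f ((Real.exp (Real.pi * z.re ^ 2) : ℂ) • gaussianAtom z) := by
      rw [map_smul, smul_eq_mul, gaborEntire, gaborTransform, stft, gaussianAtom]
      ring
    rw [h2]
    refine h1.congr_fun fun n => ?_
    simp
  have hf : gaborEntire f = fun z => ∑' n : ℕ, (Real.sqrt Real.pi : ℂ) *
      ((2 * Real.pi * z) ^ n / n.factorial * f (gaussianMonomial n)) :=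
    funext fun z => (hsum z).tsum_eq.symm
  intro z
  have hmem : z ∈ Metric.ball (0 : ℂ) (‖z‖ + 1) := by simp
  rw [hf]
  refine (Complex.differentiableOn_tsum_of_summable_norm (hsum (‖z‖ + 1 : ℝ)).summable.norm
    (fun n => by fun_prop) Metric.isOpen_ball fun n w hw => ?_).differentiableAt
    (Metric.isOpen_ball.mem_nhds hmem)
  have hw' : ‖w‖ ≤ |‖z‖ + 1| := by
    rw [abs_of_nonneg (by positivity)]
    simpa using (Metric.mem_ball.1 hw).le
  simp only [norm_mul, norm_div, norm_pow, Complex.norm_real, Real.norm_eq_abs]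
  gcongr

theorem continuous_gaborTransform (f : 𝓢'(ℝ, ℂ)) : Continuous (gaborTransform f) := by
  have h : gaborTransform f = fun z =>
      (Real.exp (-(Real.pi * z.re ^ 2)) : ℂ) * gaborEntire f z := by
    ext z
    rw [gaborEntire, ← mul_assoc, ← Complex.ofReal_mul, ← Real.exp_add]
    simp
  rw [h]
  have := (differentiable_gaborEntire f).continuous
  fun_prop

/-! ### A local sub-mean value inequality for the Gabor transform -/

theorem two_pi_mul_enorm_le_lintegral_circle {K : ℂ → ℂ} (hK : Differentiable ℂ K) (c : ℂ) (ρ : ℝ) :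
    ENNReal.ofReal (2 * Real.pi) * ‖K c‖ₑ ≤
      ∫⁻ θ in Set.Ioo (-Real.pi) Real.pi, ‖K (circleMap c ρ θ)‖ₑ := by
  have h1 : Real.circleAverage K c ρ = K c := hK.diffContOnCl.circleAverage
  have h2 : ∫ θ in (-Real.pi)..Real.pi, K (circleMap c ρ θ) = (2 * Real.pi : ℝ) • K c := by
    have hper : Function.Periodic (fun θ => K (circleMap c ρ θ)) (2 * Real.pi) := fun θ => by
      simp only [periodic_circleMap c ρ θ]
    have := hper.intervalIntegral_add_eq (-Real.pi) 0
    rw [show -Real.pi + 2 * Real.pi = Real.pi by ring, zero_add] at this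
    rw [this, ← h1, Real.circleAverage, smul_smul, mul_inv_cancel₀ (by positivity), one_smul]
  rw [intervalIntegral.integral_of_le (by linarith [Real.pi_pos]), integral_Ioc_eq_integral_Ioo]
    at h2
  calc ENNReal.ofReal (2 * Real.pi) * ‖K c‖ₑ = ‖(2 * Real.pi : ℝ) • K c‖ₑ := by
        rw [enorm_smul, Real.enorm_of_nonneg (by positivity)]
    _ ≤ _ := by rw [← h2]; exact enorm_integral_le_lintegral_enorm _

/-- The sub-mean value inequality on discs for the modulus of an entire function. -/
theorem area_mul_enorm_le_lintegral_ball {K : ℂ → ℂ} (hK : Differentiable ℂ K) (c : ℂ) {r : ℝ}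
    (hr : 0 ≤ r) :
    ENNReal.ofReal (Real.pi * r ^ 2) * ‖K c‖ₑ ≤ ∫⁻ w in Metric.ball c r, ‖K w‖ₑ := by
  have hKc : Continuous K := hK.continuous
  have hpolar : ∫⁻ w in Metric.ball c r, ‖K w‖ₑ =
      ∫⁻ ρ in Set.Ioi (0 : ℝ), ∫⁻ θ in Set.Ioo (-Real.pi) Real.pi,
        ENNReal.ofReal ρ * (Set.Iio r).indicator 1 ρ * ‖K (circleMap c ρ θ)‖ₑ := by
    have hmeas : Measurable fun p : ℝ × ℝ => ENNReal.ofReal p.1 * (Set.Iio r).indicator 1 p.1 *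
        ‖K (circleMap c p.1 p.2)‖ₑ := by
      have h1 : Measurable fun p : ℝ × ℝ => ‖K (circleMap c p.1 p.2)‖ₑ := by
        refine (hKc.comp ?_).enorm.measurable
        simp only [circleMap]; fun_prop
      have h2 : Measurable ((Set.Iio r).indicator (1 : ℝ → ENNReal)) :=
        measurable_one.indicator measurableSet_Iio
      fun_prop
    rw [← lintegral_indicator Metric.isOpen_ball.measurableSet, ← lintegral_add_left_eq_self _ c,
      ← Complex.lintegral_comp_polarCoord_symm, polarCoord_target, Measure.volume_eq_prod,
      ← Measure.prod_restrict, ← lintegral_prod _ hmeas.aemeasurable, Measure.prod_restrict]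
    refine setLIntegral_congr_fun (measurableSet_Ioi.prod measurableSet_Ioo) fun p hp => ?_
    have hp0 : 0 < p.1 := hp.1
    have hsymm : c + Complex.polarCoord.symm p = circleMap c p.1 p.2 := by
      rw [Complex.polarCoord_symm_apply, circleMap, Complex.exp_mul_I, Complex.ofReal_cos,
        Complex.ofReal_sin]
    have hmem : circleMap c p.1 p.2 ∈ Metric.ball c r ↔ p.1 ∈ Set.Iio r := by
      rw [mem_ball_iff_norm, circleMap_sub_center, norm_circleMap_zero, abs_of_pos hp0, Set.mem_Iio]
    simp only [hsymm, smul_eq_mul]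
    by_cases h : p.1 ∈ Set.Iio r
    · rw [Set.indicator_of_mem (hmem.2 h), Set.indicator_of_mem h]; simp
    · rw [Set.indicator_of_notMem (fun h' => h (hmem.1 h')), Set.indicator_of_notMem h]; simp
  have hrad : ∫⁻ ρ in Set.Ioi (0 : ℝ), ENNReal.ofReal ρ * (Set.Iio r).indicator 1 ρ =
      ENNReal.ofReal (r ^ 2 / 2) := by
    have h1 : ∀ ρ : ℝ, ENNReal.ofReal ρ * (Set.Iio r).indicator 1 ρ =
        (Set.Iio r).indicator (fun ρ => ENNReal.ofReal ρ) ρ := by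
      intro ρ
      by_cases h : ρ ∈ Set.Iio r <;> simp [h]
    simp_rw [h1]
    rw [lintegral_indicator measurableSet_Iio, Measure.restrict_restrict measurableSet_Iio,
      Set.inter_comm, Set.Ioi_inter_Iio, ← ofReal_integral_eq_lintegral_ofReal,
      ← integral_Ioc_eq_integral_Ioo, ← intervalIntegral.integral_of_le hr, integral_id]
    · simp
    · exact (continuous_id.integrableOn_Icc).mono_set Set.Ioo_subset_Icc_self
    · exact (ae_restrict_mem measurableSet_Ioo).mono fun x hx => hx.1.le
  rw [hpolar]
  calc ENNReal.ofReal (Real.pi * r ^ 2) * ‖K c‖ₑ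
      = ∫⁻ ρ in Set.Ioi (0 : ℝ), ENNReal.ofReal ρ * (Set.Iio r).indicator 1 ρ *
          (ENNReal.ofReal (2 * Real.pi) * ‖K c‖ₑ) := by
        rw [lintegral_mul_const' _ _ (ENNReal.mul_ne_top ENNReal.ofReal_ne_top enorm_ne_top), hrad,
          ← mul_assoc, ← ENNReal.ofReal_mul (by positivity)]
        congr 2
        ring
    _ ≤ _ := by
        refine lintegral_mono fun ρ => ?_
        rw [lintegral_const_mul]
        · gcongr
          exact two_pi_mul_enorm_le_lintegral_circle hK c ρ
        · exact (hKc.comp (continuous_circleMap c ρ)).enorm.measurable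

/-- The modulus of the Gabor transform satisfies a sub-mean value inequality after multiplication by
a factor close to `1` near the centre. It is used in exponential form: for `a = H(z₀)`, the entire
function `exp (2 lam ā H - lam |a|²)` has modulus at most `exp (lam |H|²)`, with equality
at `z₀`. Here `H` is the product of `e^{πu²} F[f]` and the exponential of a linear function, chosen
so that `|H(z)| = |F[f](z)| e^{π(u-u₀)²}`. -/
theorem area_mul_exp_gaborTransform_le (f : 𝓢'(ℝ, ℂ)) (z₀ : ℂ) {r lam : ℝ} (hr : 0 ≤ r)
    (hlam : 0 ≤ lam) :
    ENNReal.ofReal (Real.pi * r ^ 2) * ENNReal.ofReal (Real.exp (lam * ‖gaborTransform f z₀‖ ^ 2)) ≤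
      ∫⁻ w in Metric.ball z₀ r, ENNReal.ofReal
        (Real.exp (lam * Real.exp (2 * Real.pi * r ^ 2) * ‖gaborTransform f w‖ ^ 2)) := by
  set H : ℂ → ℂ := fun z => gaborEntire f z *
    Complex.exp (-(2 * Real.pi * z₀.re) * z + (Real.pi * z₀.re ^ 2 : ℝ)) with hH
  have hHd : Differentiable ℂ H := by
    have := differentiable_gaborEntire f
    fun_prop
  have hHnorm : ∀ z, ‖H z‖ = Real.exp (Real.pi * (z.re - z₀.re) ^ 2) * ‖gaborTransform f z‖ := by
    intro z
    have hre : (-(2 * Real.pi * z₀.re : ℂ) * z + (Real.pi * z₀.re ^ 2 : ℝ)).re =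
        -(2 * Real.pi * z₀.re) * z.re + Real.pi * z₀.re ^ 2 := by
      have : (-(2 * Real.pi * z₀.re : ℂ) * z) = ((-(2 * Real.pi * z₀.re) : ℝ) : ℂ) * z := by
        push_cast; ring
      rw [Complex.add_re, this, Complex.re_ofReal_mul, Complex.ofReal_re]
    rw [hH]
    simp only [gaborEntire]
    rw [norm_mul, norm_mul, Complex.norm_real, Complex.norm_exp, hre,
      Real.norm_of_nonneg (Real.exp_pos _).le, mul_right_comm, ← Real.exp_add]
    congr 2
    ring
  have hH0 : ‖H z₀‖ = ‖gaborTransform f z₀‖ := by simp [hHnorm]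
  set a := H z₀ with ha
  set K : ℂ → ℂ := fun z => Complex.exp (2 * lam * (starRingEnd ℂ a) * H z - (lam * ‖a‖ ^ 2 : ℝ))
    with hK
  have hKd : Differentiable ℂ K := by fun_prop
  have hKre : ∀ z, ‖K z‖ = Real.exp (2 * lam * (starRingEnd ℂ a * H z).re - lam * ‖a‖ ^ 2) := by
    intro z
    have h1 : (2 * lam * (starRingEnd ℂ a) * H z : ℂ) =
        ((2 * lam : ℝ) : ℂ) * (starRingEnd ℂ a * H z) := by push_cast; ring
    rw [hK]
    simp only
    rw [Complex.norm_exp, h1, Complex.sub_re, Complex.re_ofReal_mul, Complex.ofReal_re]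
  have hKle : ∀ z, ‖K z‖ ≤ Real.exp (lam * ‖H z‖ ^ 2) := by
    intro z
    rw [hKre, Real.exp_le_exp]
    have h1 : (starRingEnd ℂ a * H z).re ≤ ‖a‖ * ‖H z‖ := by
      refine (Complex.re_le_norm _).trans ?_
      rw [norm_mul, Complex.norm_conj]
    nlinarith [mul_le_mul_of_nonneg_left h1 hlam, mul_nonneg hlam (sq_nonneg (‖a‖ - ‖H z‖))]
  have hK0 : ‖K z₀‖ = Real.exp (lam * ‖gaborTransform f z₀‖ ^ 2) := by
    rw [hKre, ← ha, mul_comm (starRingEnd ℂ a), Complex.mul_conj, Complex.ofReal_re,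
      Complex.normSq_eq_norm_sq, ← hH0]
    congr 1
    ring
  have hmean := area_mul_enorm_le_lintegral_ball hKd z₀ hr
  rw [← ofReal_norm, hK0] at hmean
  refine hmean.trans (setLIntegral_mono' Metric.isOpen_ball.measurableSet fun w hw => ?_)
  rw [← ofReal_norm]
  refine ENNReal.ofReal_le_ofReal ((hKle w).trans (Real.exp_le_exp.2 ?_))
  have hre : (w.re - z₀.re) ^ 2 ≤ r ^ 2 := by
    rw [sq_le_sq, abs_of_nonneg hr, ← Complex.sub_re]
    exact (Complex.abs_re_le_norm _).trans (mem_ball_iff_norm.1 hw).le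
  rw [hHnorm, mul_pow, ← Real.exp_nat_mul, mul_assoc]
  have hexp : ((2 : ℕ) : ℝ) * (Real.pi * (w.re - z₀.re) ^ 2) ≤ 2 * Real.pi * r ^ 2 := by
    push_cast
    rw [← mul_assoc]
    gcongr
  have := Real.exp_le_exp.2 hexp
  gcongr

/-! ### Exponential moments under white noise -/

theorem measurable_apply_schwartz (φ : 𝓢(ℝ, ℂ)) : Measurable fun f : 𝓢'(ℝ, ℂ) => f φ :=
  (PointwiseConvergenceCLM.evalCLM (RingHom.id ℂ) ℂ φ).continuous.measurable

/-- Under white noise, a real test function `φ` yields a centred normal variable with variance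
`‖φ‖²`. -/
theorem IsWhiteNoiseMeasure.map_re_apply {μ : Measure (𝓢'(ℝ, ℂ))} (hμ : IsWhiteNoiseMeasure μ)
    {φ : 𝓢(ℝ, ℂ)} (hφ : ∀ t, (φ t).im = 0) :
    μ.map (fun f => (f φ).re) = gaussianReal 0 (∫ t, ‖φ t‖ ^ 2).toNNReal := by
  have := hμ.isProbabilityMeasure
  have hmeas : Measurable fun f : 𝓢'(ℝ, ℂ) => (f φ).re :=
    Complex.measurable_re.comp (measurable_apply_schwartz φ)
  have := Measure.isProbabilityMeasure_map (μ := μ) hmeas.aemeasurable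
  refine Measure.ext_of_charFun (funext fun s => ?_)
  have hs := hμ.charFun_eq ((s : ℂ) • φ) fun t => by simp [hφ t]
  have hnorm : ∫ t, ‖((s : ℂ) • φ) t‖ ^ 2 = s ^ 2 * ∫ t, ‖φ t‖ ^ 2 := by
    rw [← integral_const_mul]
    simp [mul_pow]
  rw [hnorm] at hs
  rw [charFun_apply_real, integral_map hmeas.aemeasurable (by fun_prop), charFun_gaussianReal,
    Real.coe_toNNReal _ (integral_nonneg fun _ => by positivity)]
  have hint : ∫ f, Complex.exp (s * ((f φ).re : ℝ) * Complex.I) ∂μ =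
      ∫ f : 𝓢'(ℝ, ℂ), Complex.exp (Complex.I * f ((s : ℂ) • φ)) ∂μ := by
    refine integral_congr_ae ?_
    filter_upwards [hμ.real_valued φ hφ] with f hf
    have : f φ = ((f φ).re : ℂ) := Complex.ext (by simp) (by simp [hf])
    rw [map_smul, smul_eq_mul, ← this]
    ring_nf
  rw [hint, hs, Complex.ofReal_exp]
  congr 1
  push_cast
  ring

theorem lintegral_exp_sq_gaussianReal :
    ∫⁻ x, ENNReal.ofReal (Real.exp (3 / 8 * x ^ 2)) ∂(gaussianReal 0 1) = 2 := by
  rw [gaussianReal_of_var_ne_zero _ one_ne_zero,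
    lintegral_withDensity_eq_lintegral_mul _ (measurable_gaussianPDF 0 1) (by fun_prop)]
  have h1 : ∀ x : ℝ, (gaussianPDF 0 1 * fun x => ENNReal.ofReal (Real.exp (3 / 8 * x ^ 2))) x =
      ENNReal.ofReal ((Real.sqrt (2 * Real.pi))⁻¹ * Real.exp (-(1 / 8) * x ^ 2)) := by
    intro x
    rw [Pi.mul_apply, gaussianPDF, gaussianPDFReal, ← ENNReal.ofReal_mul (by positivity), mul_assoc,
      ← Real.exp_add]
    congr 2
    · simp
    · congr 1; simp; ring
  simp_rw [h1]
  rw [← ofReal_integral_eq_lintegral_ofReal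
    ((integrable_exp_neg_mul_sq (by norm_num)).const_mul _)
    (Filter.Eventually.of_forall fun _ => by positivity), integral_const_mul, integral_gaussian]
  have h2 : Real.sqrt (Real.pi / (1 / 8)) = 2 * Real.sqrt (2 * Real.pi) := by
    rw [show Real.pi / (1 / 8) = 2 ^ 2 * (2 * Real.pi) by ring, Real.sqrt_mul (by positivity),
      Real.sqrt_sq (by norm_num)]
  have h3 : Real.sqrt (2 * Real.pi) ≠ 0 := by positivity
  rw [h2, mul_left_comm, inv_mul_cancel₀ h3]
  simp

/-- The exponential moment of the square of a normalized Gaussian variable. For `φ = 0` the quotient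
is `0` by the convention on division, and the bound is trivial. -/
theorem IsWhiteNoiseMeasure.lintegral_exp_sq_div_le {μ : Measure (𝓢'(ℝ, ℂ))}
    (hμ : IsWhiteNoiseMeasure μ) {φ : 𝓢(ℝ, ℂ)} (hφ : ∀ t, (φ t).im = 0) :
    ∫⁻ f, ENNReal.ofReal
      (Real.exp (3 / 8 * ((f φ).re / Real.sqrt (∫ t, ‖φ t‖ ^ 2)) ^ 2)) ∂μ ≤ 2 := by
  have := hμ.isProbabilityMeasure
  set v := ∫ t, ‖φ t‖ ^ 2 with hv
  have hv0 : 0 ≤ v := integral_nonneg fun _ => by positivity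
  rcases hv0.eq_or_lt with h | h
  · simp [← h]
  have hmeas : Measurable fun f : 𝓢'(ℝ, ℂ) => (f φ).re :=
    Complex.measurable_re.comp (measurable_apply_schwartz φ)
  have hmap : (gaussianReal 0 v.toNNReal).map (fun x => x / Real.sqrt v) = gaussianReal 0 1 := by
    rw [gaussianReal_map_div_const]
    congr 1
    · simp
    · ext
      simp [Real.coe_toNNReal _ hv0, Real.sq_sqrt hv0, h.ne']
  rw [← lintegral_exp_sq_gaussianReal, ← hmap, lintegral_map (by fun_prop) (by fun_prop),
    ← hμ.map_re_apply hφ, lintegral_map (by fun_prop) hmeas]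

theorem IsWhiteNoiseMeasure.re_apply_eq_zero {μ : Measure (𝓢'(ℝ, ℂ))}
    (hμ : IsWhiteNoiseMeasure μ) {φ : 𝓢(ℝ, ℂ)} (hφ : ∀ t, (φ t).im = 0)
    (h0 : ∫ t, ‖φ t‖ ^ 2 = 0) : ∀ᵐ f ∂μ, (f φ).re = 0 := by
  have hmeas : Measurable fun f : 𝓢'(ℝ, ℂ) => (f φ).re :=
    Complex.measurable_re.comp (measurable_apply_schwartz φ)
  have h := hμ.map_re_apply hφ
  rw [h0, Real.toNNReal_zero, gaussianReal_zero_var] at h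
  refine ae_of_ae_map (p := fun x => x = 0) hmeas.aemeasurable ?_
  rw [h]
  exact (ae_dirac_iff (measurableSet_singleton 0)).2 rfl

/-- For real test functions `φ`, `ψ` with `‖φ‖² + ‖ψ‖² = 1`, convexity of the exponential reduces
the moment of the sum of squares to the marginal laws, so that the joint law is not needed. -/
theorem IsWhiteNoiseMeasure.lintegral_exp_add_sq_le {μ : Measure (𝓢'(ℝ, ℂ))}
    (hμ : IsWhiteNoiseMeasure μ) {φ ψ : 𝓢(ℝ, ℂ)} (hφ : ∀ t, (φ t).im = 0)
    (hψ : ∀ t, (ψ t).im = 0) (hsum : (∫ t, ‖φ t‖ ^ 2) + ∫ t, ‖ψ t‖ ^ 2 = 1) :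
    ∫⁻ f, ENNReal.ofReal (Real.exp (3 / 8 * ((f φ).re ^ 2 + (f ψ).re ^ 2))) ∂μ ≤ 2 := by
  have hsq : ∀ χ : 𝓢(ℝ, ℂ), (∀ t, (χ t).im = 0) → ∀ᵐ f ∂μ, (f χ).re ^ 2 =
      (∫ t, ‖χ t‖ ^ 2) * ((f χ).re / Real.sqrt (∫ t, ‖χ t‖ ^ 2)) ^ 2 := by
    intro χ hχ
    have hv0 : 0 ≤ ∫ t, ‖χ t‖ ^ 2 := integral_nonneg fun _ => by positivity
    by_cases h : ∫ t, ‖χ t‖ ^ 2 = 0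
    · filter_upwards [hμ.re_apply_eq_zero hχ h] with f hf
      simp [hf]
    · refine Filter.Eventually.of_forall fun f => ?_
      rw [div_pow, Real.sq_sqrt hv0, mul_div_cancel₀ _ h]
  have hmeas : ∀ χ : 𝓢(ℝ, ℂ), Measurable fun f : 𝓢'(ℝ, ℂ) => (f χ).re := fun χ =>
    Complex.measurable_re.comp (measurable_apply_schwartz χ)
  have hmφ := hmeas φ
  have hmψ := hmeas ψ
  set a := ∫ t, ‖φ t‖ ^ 2 with ha
  set b := ∫ t, ‖ψ t‖ ^ 2 with hb
  have ha0 : 0 ≤ a := integral_nonneg fun _ => by positivity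
  have hb0 : 0 ≤ b := integral_nonneg fun _ => by positivity
  calc ∫⁻ f, ENNReal.ofReal (Real.exp (3 / 8 * ((f φ).re ^ 2 + (f ψ).re ^ 2))) ∂μ
      ≤ ∫⁻ f, (ENNReal.ofReal a * ENNReal.ofReal (Real.exp (3 / 8 * ((f φ).re / Real.sqrt a) ^ 2)) +
          ENNReal.ofReal b * ENNReal.ofReal (Real.exp (3 / 8 * ((f ψ).re / Real.sqrt b) ^ 2)))
            ∂μ := by
        refine lintegral_mono_ae ?_
        filter_upwards [hsq φ hφ, hsq ψ hψ] with f h1 h2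
        rw [← ENNReal.ofReal_mul ha0, ← ENNReal.ofReal_mul hb0,
          ← ENNReal.ofReal_add (by positivity) (by positivity), h1, h2]
        refine ENNReal.ofReal_le_ofReal ?_
        have := convexOn_exp.2 (Set.mem_univ (3 / 8 * ((f φ).re / Real.sqrt a) ^ 2))
          (Set.mem_univ (3 / 8 * ((f ψ).re / Real.sqrt b) ^ 2)) ha0 hb0 hsum
        simp only [smul_eq_mul] at this
        refine le_trans (le_of_eq ?_) this
        congr 1
        ring
    _ ≤ ENNReal.ofReal a * 2 + ENNReal.ofReal b * 2 := by
        rw [lintegral_add_left (by fun_prop), lintegral_const_mul _ (by fun_prop),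
          lintegral_const_mul _ (by fun_prop)]
        gcongr
        · exact hμ.lintegral_exp_sq_div_le hφ
        · exact hμ.lintegral_exp_sq_div_le hψ
    _ = 2 := by rw [← add_mul, ← ENNReal.ofReal_add ha0 hb0, hsum]; simp

/-- The real part of the time-frequency shifted Gaussian. -/
noncomputable def gaussianAtomRe (z : ℂ) : 𝓢(ℝ, ℂ) :=
  (1 / 2 : ℂ) • (gaussianAtom z + gaussianAtom (starRingEnd ℂ z))

/-- The imaginary part of the time-frequency shifted Gaussian. -/
noncomputable def gaussianAtomIm (z : ℂ) : 𝓢(ℝ, ℂ) :=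
  (-Complex.I / 2 : ℂ) • (gaussianAtom z - gaussianAtom (starRingEnd ℂ z))

theorem gaussianAtomRe_apply (z : ℂ) (t : ℝ) :
    gaussianAtomRe z t = (Real.cos (2 * Real.pi * z.im * t) * gaussian (t - z.re) : ℝ) := by
  rw [gaussianAtomRe, smul_apply, add_apply, gaussianAtom_apply, gaussianAtom_apply,
    Complex.conj_re, Complex.conj_im, smul_eq_mul, ← add_mul]
  push_cast
  rw [Complex.cos]
  ring_nf

theorem gaussianAtomIm_apply (z : ℂ) (t : ℝ) :
    gaussianAtomIm z t = (Real.sin (2 * Real.pi * z.im * t) * gaussian (t - z.re) : ℝ) := by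
  rw [gaussianAtomIm, smul_apply, sub_apply, gaussianAtom_apply, gaussianAtom_apply,
    Complex.conj_re, Complex.conj_im, smul_eq_mul, ← sub_mul]
  push_cast
  rw [Complex.sin]
  ring_nf

theorem gaussianAtom_eq (z : ℂ) :
    gaussianAtom z = gaussianAtomRe z + Complex.I • gaussianAtomIm z := by
  have h : Complex.I * (-Complex.I / 2) = 1 / 2 := by
    linear_combination (-1 / 2 : ℂ) * Complex.I_mul_I
  rw [gaussianAtomRe, gaussianAtomIm, smul_smul, h, ← smul_add, add_add_sub_cancel, smul_add,
    ← add_smul]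
  norm_num

theorem integral_norm_gaussianAtom_parts (z : ℂ) :
    (∫ t, ‖gaussianAtomRe z t‖ ^ 2) + ∫ t, ‖gaussianAtomIm z t‖ ^ 2 = 1 := by
  have hint : ∀ φ : 𝓢(ℝ, ℂ), Integrable fun t => ‖φ t‖ ^ 2 := fun φ =>
    (φ.memLp 2).integrable_norm_pow (by norm_num)
  rw [← integral_add (hint _) (hint _)]
  have h : ∀ t, ‖gaussianAtomRe z t‖ ^ 2 + ‖gaussianAtomIm z t‖ ^ 2 =
      Real.sqrt 2 * Real.exp (-(2 * Real.pi) * (t - z.re) ^ 2) := by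
    intro t
    rw [gaussianAtomRe_apply, gaussianAtomIm_apply, Complex.norm_real, Complex.norm_real,
      Real.norm_eq_abs, Real.norm_eq_abs, sq_abs, sq_abs, mul_pow, mul_pow, ← add_mul,
      Real.cos_sq_add_sin_sq, one_mul, gaussian, mul_pow, ← Real.exp_nat_mul, ← Real.rpow_natCast,
      ← Real.rpow_mul (by norm_num), Real.sqrt_eq_rpow]
    norm_num
    ring_nf
  simp_rw [h]
  rw [integral_const_mul, integral_sub_right_eq_self
    (fun t : ℝ => Real.exp (-(2 * Real.pi) * t ^ 2)) z.re, integral_gaussian,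
    ← Real.sqrt_mul (by norm_num)]
  rw [show 2 * (Real.pi / (2 * Real.pi)) = 1 by field_simp, Real.sqrt_one]

theorem IsWhiteNoiseMeasure.lintegral_exp_gaborTransform_le {μ : Measure (𝓢'(ℝ, ℂ))}
    (hμ : IsWhiteNoiseMeasure μ) (z : ℂ) :
    ∫⁻ f, ENNReal.ofReal (Real.exp (3 / (8 * Real.pi) * ‖gaborTransform f z‖ ^ 2)) ∂μ ≤ 2 := by
  have hre : ∀ t, (gaussianAtomRe z t).im = 0 := fun t => by
    rw [gaussianAtomRe_apply, Complex.ofReal_im]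
  have him : ∀ t, (gaussianAtomIm z t).im = 0 := fun t => by
    rw [gaussianAtomIm_apply, Complex.ofReal_im]
  refine le_trans (lintegral_mono_ae ?_)
    (hμ.lintegral_exp_add_sq_le hre him (integral_norm_gaussianAtom_parts z))
  filter_upwards [hμ.real_valued _ hre, hμ.real_valued _ him] with f h1 h2
  refine ENNReal.ofReal_le_ofReal (le_of_eq ?_)
  have h3 : gaborTransform f z = (Real.sqrt Real.pi : ℂ) *
      (f (gaussianAtomRe z) + Complex.I * f (gaussianAtomIm z)) := by
    rw [gaborTransform, stft, ← gaussianAtom, gaussianAtom_eq, map_add, map_smul, smul_eq_mul]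
  rw [h3, norm_mul, mul_pow, Complex.norm_real, Real.norm_eq_abs, sq_abs,
    Real.sq_sqrt Real.pi_pos.le, ← Complex.normSq_eq_norm_sq, Complex.normSq_apply]
  simp only [Complex.add_re, Complex.add_im, Complex.mul_re, Complex.mul_im, Complex.I_re,
    Complex.I_im, h1, h2]
  congr 1
  field_simp
  ring

/-! ### From local exponential moments to the supremum over a square -/

theorem mem_square_iff {L : ℝ} {z : ℂ} : z ∈ square L ↔ |z.re| ≤ L ∧ |z.im| ≤ L :=
  max_le_iff (a := |z.re|) (b := |z.im|)

theorem square_eq_reProdIm (L : ℝ) : square L = Set.Icc (-L) L ×ℂ Set.Icc (-L) L := by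
  ext z
  rw [Complex.mem_reProdIm, Set.mem_Icc, Set.mem_Icc, ← abs_le, ← abs_le, mem_square_iff]

theorem volume_square (L : ℝ) :
    volume (square L) = ENNReal.ofReal (2 * L) * ENNReal.ofReal (2 * L) := by
  have h : square L = Complex.measurableEquivRealProd ⁻¹' (Set.Icc (-L) L ×ˢ Set.Icc (-L) L) := by
    rw [square_eq_reProdIm]
    rfl
  rw [h, Complex.volume_preserving_equiv_real_prod.measure_preimage
    (measurableSet_Icc.prod measurableSet_Icc).nullMeasurableSet, Measure.volume_eq_prod,
    Measure.prod_prod, Real.volume_Icc]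
  ring_nf

theorem ball_subset_square {L r : ℝ} {z : ℂ} (hz : z ∈ square L) :
    Metric.ball z r ⊆ square (L + r) := by
  intro w hw
  have hw' : ‖w - z‖ ≤ r := (mem_ball_iff_norm.1 hw).le
  have hz' := mem_square_iff.1 hz
  refine mem_square_iff.2 ⟨?_, ?_⟩
  · calc |w.re| = |z.re + (w - z).re| := by simp
      _ ≤ |z.re| + |(w - z).re| := abs_add_le _ _
      _ ≤ L + r := add_le_add hz'.1 ((Complex.abs_re_le_norm _).trans hw')
  · calc |w.im| = |z.im + (w - z).im| := by simp
      _ ≤ |z.im| + |(w - z).im| := abs_add_le _ _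
      _ ≤ L + r := add_le_add hz'.2 ((Complex.abs_im_le_norm _).trans hw')

/-- The exponential energy of the Gabor transform over the square of half-side `L`. The exponent
`3 / (8π)` is below the critical value `1 / (2π)` for the moments under white noise. -/
noncomputable def exponentialEnergy (L : ℝ) (f : 𝓢'(ℝ, ℂ)) : ENNReal :=
  ∫⁻ w in square L, ENNReal.ofReal (Real.exp (3 / (8 * Real.pi) * ‖gaborTransform f w‖ ^ 2))

theorem measurable_exp_gaborTransform : Measurable fun p : 𝓢'(ℝ, ℂ) × ℂ =>
    ENNReal.ofReal (Real.exp (3 / (8 * Real.pi) * ‖gaborTransform p.1 p.2‖ ^ 2)) := by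
  have h : Measurable (Function.uncurry fun (z : ℂ) (f : 𝓢'(ℝ, ℂ)) => gaborTransform f z) :=
    measurable_uncurry_of_continuous_of_measurable continuous_gaborTransform fun z =>
      (measurable_apply_schwartz _).const_mul _
  have h' : Measurable fun p : 𝓢'(ℝ, ℂ) × ℂ => gaborTransform p.1 p.2 := h.comp measurable_swap
  fun_prop

theorem measurable_exponentialEnergy (L : ℝ) : Measurable (exponentialEnergy L) :=
  measurable_exp_gaborTransform.lintegral_prod_right'

theorem IsWhiteNoiseMeasure.lintegral_exponentialEnergy_le {μ : Measure (𝓢'(ℝ, ℂ))}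
    (hμ : IsWhiteNoiseMeasure μ) (L : ℝ) :
    ∫⁻ f, exponentialEnergy L f ∂μ ≤ 2 * volume (square L) := by
  have := hμ.isProbabilityMeasure
  unfold exponentialEnergy
  rw [lintegral_lintegral_swap measurable_exp_gaborTransform.aemeasurable]
  refine (lintegral_mono fun z => hμ.lintegral_exp_gaborTransform_le z).trans ?_
  simp

/-- A large value of the Gabor transform in the square forces a large exponential energy in the
square enlarged by `1/5`. The radius `1/5` is so small that the loss `e^{2π/25}` in the sub-mean
value inequality is below `3/2`, which leaves an exponent `1/(4π)`. -/
theorem le_exponentialEnergy (f : 𝓢'(ℝ, ℂ)) {L s : ℝ} {z : ℂ} (hz : z ∈ square L) (hs : 0 ≤ s)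
    (hsz : s ≤ ‖gaborTransform f z‖) :
    ENNReal.ofReal (Real.pi / 25 * Real.exp (s ^ 2 / (4 * Real.pi))) ≤
      exponentialEnergy (L + 1 / 5) f := by
  have hpi := Real.pi_pos
  have hexp : Real.exp (2 * Real.pi * (1 / 5) ^ 2) ≤ 3 / 2 := by
    have h1 : 2 * Real.pi * (1 / 5) ^ 2 ≤ 1 / 3 := by nlinarith [Real.pi_lt_d2]
    have h2 : 1 - 1 / 3 ≤ Real.exp (-(1 / 3 : ℝ)) := by
      have := Real.add_one_le_exp (-(1 / 3 : ℝ)); linarith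
    rw [Real.exp_neg] at h2
    calc Real.exp (2 * Real.pi * (1 / 5) ^ 2) ≤ Real.exp (1 / 3) := Real.exp_le_exp.2 h1
      _ ≤ 3 / 2 := by
        rw [le_inv_comm₀ (by norm_num) (Real.exp_pos _)] at h2
        norm_num at h2 ⊢
        exact h2
  have hmean := area_mul_exp_gaborTransform_le f z (r := 1 / 5) (lam := 1 / (4 * Real.pi))
    (by norm_num) (by positivity)
  calc ENNReal.ofReal (Real.pi / 25 * Real.exp (s ^ 2 / (4 * Real.pi)))
      ≤ ENNReal.ofReal (Real.pi * (1 / 5) ^ 2) *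
          ENNReal.ofReal (Real.exp (1 / (4 * Real.pi) * ‖gaborTransform f z‖ ^ 2)) := by
        rw [← ENNReal.ofReal_mul (by positivity)]
        refine ENNReal.ofReal_le_ofReal ?_
        rw [show Real.pi / 25 = Real.pi * (1 / 5) ^ 2 by ring, div_eq_mul_one_div (s ^ 2),
          mul_comm (s ^ 2)]
        gcongr
    _ ≤ _ := hmean
    _ ≤ ∫⁻ w in Metric.ball z (1 / 5), ENNReal.ofReal
          (Real.exp (3 / (8 * Real.pi) * ‖gaborTransform f w‖ ^ 2)) := by
        refine lintegral_mono fun w => ENNReal.ofReal_le_ofReal (Real.exp_le_exp.2 ?_)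
        gcongr
        calc 1 / (4 * Real.pi) * Real.exp (2 * Real.pi * (1 / 5) ^ 2)
            ≤ 1 / (4 * Real.pi) * (3 / 2) := by gcongr
          _ = 3 / (8 * Real.pi) := by field_simp; norm_num
    _ ≤ _ := lintegral_mono_set (ball_subset_square hz)

theorem IsWhiteNoiseMeasure.measure_exists_gt_le {μ : Measure (𝓢'(ℝ, ℂ))}
    (hμ : IsWhiteNoiseMeasure μ) {L s : ℝ} (hL : 0 ≤ L) (hs : 0 ≤ s) :
    μ {f | ∃ z ∈ square L, s < ‖gaborTransform f z‖} ≤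
      ENNReal.ofReal (200 / Real.pi * (L + 1 / 5) ^ 2 * Real.exp (-(s ^ 2 / (4 * Real.pi)))) := by
  have hpi := Real.pi_pos
  set ε : ℝ := Real.pi / 25 * Real.exp (s ^ 2 / (4 * Real.pi)) with hε
  have hε0 : 0 < ε := by positivity
  calc μ {f | ∃ z ∈ square L, s < ‖gaborTransform f z‖}
      ≤ μ {f | ENNReal.ofReal ε ≤ exponentialEnergy (L + 1 / 5) f} :=
        measure_mono fun f ⟨_, hz, hsz⟩ => le_exponentialEnergy f hz hs hsz.le
    _ ≤ (∫⁻ f, exponentialEnergy (L + 1 / 5) f ∂μ) / ENNReal.ofReal ε :=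
        meas_ge_le_lintegral_div (measurable_exponentialEnergy _).aemeasurable
          (by simpa using hε0) ENNReal.ofReal_ne_top
    _ ≤ 2 * volume (square (L + 1 / 5)) / ENNReal.ofReal ε := by
        gcongr; exact hμ.lintegral_exponentialEnergy_le _
    _ = ENNReal.ofReal (2 * (2 * (L + 1 / 5) * (2 * (L + 1 / 5))) / ε) := by
        have hside : 0 ≤ 2 * (L + 1 / 5) := by positivity
        rw [volume_square, ENNReal.ofReal_div_of_pos hε0, ← ENNReal.ofReal_mul hside,
          ENNReal.ofReal_mul (p := 2) (by norm_num), ENNReal.ofReal_ofNat]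
    _ = _ := by
        congr 1
        rw [hε, Real.exp_neg]
        field_simp
        ring

/-- The area of the enlarged square, of order `L²`, is absorbed by the factor
`exp (-14² log L / (2π)) ≤ L⁻⁶` that comes from the constant `14` in the threshold. -/
theorem area_mul_exp_le {L τ : ℝ} (hL : Real.pi ≤ L) (hτ : 0 < τ) :
    200 / Real.pi * (L + 1 / 5) ^ 2 *
        Real.exp (-((Real.sqrt 2 * (14 * 1 + τ) * Real.sqrt (Real.log L)) ^ 2 / (4 * Real.pi))) ≤
      4 * Real.exp (-(τ ^ 2 / (2 * Real.pi)) * Real.log L) := by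
  have hpi := Real.pi_pos
  have hL3 : 3 ≤ L := Real.pi_gt_three.le.trans hL
  have hlog : 0 ≤ Real.log L := Real.log_nonneg (by linarith)
  have hsq : (Real.sqrt 2 * (14 * 1 + τ) * Real.sqrt (Real.log L)) ^ 2 / (4 * Real.pi) =
      (14 + τ) ^ 2 / (2 * Real.pi) * Real.log L := by
    rw [mul_pow, mul_pow, Real.sq_sqrt (by norm_num), Real.sq_sqrt hlog]
    field_simp
    ring
  have hexp : 6 + τ ^ 2 / (2 * Real.pi) ≤ (14 + τ) ^ 2 / (2 * Real.pi) := by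
    rw [← sub_nonneg, show (14 + τ) ^ 2 / (2 * Real.pi) - (6 + τ ^ 2 / (2 * Real.pi)) =
      (196 + 28 * τ - 12 * Real.pi) / (2 * Real.pi) by field_simp; ring]
    have := Real.pi_lt_four
    exact div_nonneg (by linarith) (by positivity)
  have hL6 : Real.exp (-(6 * Real.log L)) = (L ^ 6)⁻¹ := by
    rw [Real.exp_neg, mul_comm, Real.exp_mul, Real.exp_log (by linarith)]
    norm_cast
  have hpoly : 200 / Real.pi * (L + 1 / 5) ^ 2 * (L ^ 6)⁻¹ ≤ 4 := by
    have h1 : 200 / Real.pi ≤ 200 / 3 := by gcongr; exact Real.pi_gt_three.le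
    have h2 : (L + 1 / 5) ^ 2 ≤ 4 * L ^ 2 := by nlinarith
    have h3 : (81 : ℝ) ≤ L ^ 4 := by
      calc (81 : ℝ) = 3 ^ 4 := by norm_num
        _ ≤ L ^ 4 := by gcongr
    rw [← div_eq_mul_inv, div_le_iff₀ (by positivity)]
    calc 200 / Real.pi * (L + 1 / 5) ^ 2 ≤ 200 / 3 * (4 * L ^ 2) := by gcongr
      _ ≤ 4 * (81 * L ^ 2) := by nlinarith [sq_nonneg L]
      _ ≤ 4 * (L ^ 4 * L ^ 2) := by gcongr
      _ = 4 * L ^ 6 := by ring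
  rw [hsq]
  calc 200 / Real.pi * (L + 1 / 5) ^ 2 * Real.exp (-((14 + τ) ^ 2 / (2 * Real.pi) * Real.log L))
      ≤ 200 / Real.pi * (L + 1 / 5) ^ 2 *
          Real.exp (-((6 + τ ^ 2 / (2 * Real.pi)) * Real.log L)) := by gcongr
    _ = 200 / Real.pi * (L + 1 / 5) ^ 2 * (L ^ 6)⁻¹ *
          Real.exp (-(τ ^ 2 / (2 * Real.pi)) * Real.log L) := by
        rw [← hL6, mul_assoc _ (Real.exp _), ← Real.exp_add]
        ring_nf
    _ ≤ _ := by gcongr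

end GaborNoise

theorem theorem1 :
    ∃ K : ℝ, 0 < K ∧
      ∀ (Ω : Type*) [MeasurableSpace Ω] (P : Measure Ω) [IsProbabilityMeasure P]
        (μ₁ : Measure (𝓢'(ℝ, ℂ))) (_ : GaborNoise.IsWhiteNoiseMeasure μ₁)
        (ξ : Ω → 𝓢'(ℝ, ℂ)) (_ : HasLaw ξ μ₁ P)
        (L : ℝ) (_ : Real.pi ≤ L) (τ : ℝ) (_ : 0 < τ),
        1 - 4 * Real.exp (-(τ ^ 2 / (2 * Real.pi)) * Real.log L) ≤
          P.real {ω | (⨆ z ∈ GaborNoise.square L, ‖GaborNoise.gaborTransform (ξ ω) z‖ₑ) ≤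
            ENNReal.ofReal (Real.sqrt 2 * (14 * K + τ) * Real.sqrt (Real.log L))} := by
  refine ⟨1, one_pos, fun Ω _ P _ μ₁ hμ ξ hξ L hL τ hτ => ?_⟩
  set s := Real.sqrt 2 * (14 * 1 + τ) * Real.sqrt (Real.log L) with hs
  have hs0 : 0 ≤ s := by positivity
  set A := {ω | (⨆ z ∈ GaborNoise.square L, ‖GaborNoise.gaborTransform (ξ ω) z‖ₑ) ≤
    ENNReal.ofReal s} with hA
  have hAc : Aᶜ ⊆ ξ ⁻¹' {f | ∃ z ∈ GaborNoise.square L, s < ‖GaborNoise.gaborTransform f z‖} := by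
    intro ω hω
    by_contra hcon
    refine hω ?_
    rw [hA, Set.mem_ofPred_eq]
    refine iSup₂_le fun z hz => ?_
    rw [← ofReal_norm]
    exact ENNReal.ofReal_le_ofReal (not_lt.1 fun h => hcon ⟨z, hz, h⟩)
  have hbad : P Aᶜ ≤ ENNReal.ofReal (4 * Real.exp (-(τ ^ 2 / (2 * Real.pi)) * Real.log L)) := by
    calc P Aᶜ ≤ P (ξ ⁻¹' {f | ∃ z ∈ GaborNoise.square L, s < ‖GaborNoise.gaborTransform f z‖}) :=
          measure_mono hAc
      _ ≤ μ₁ {f | ∃ z ∈ GaborNoise.square L, s < ‖GaborNoise.gaborTransform f z‖} := by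
          rw [← hξ.map_eq]
          exact Measure.le_map_apply hξ.aemeasurable _
      _ ≤ _ := hμ.measure_exists_gt_le (Real.pi_pos.le.trans hL) hs0
      _ ≤ _ := ENNReal.ofReal_le_ofReal (GaborNoise.area_mul_exp_le hL hτ)
  -- Subadditivity of the outer measure suffices, so measurability of `A` is not needed.
  have hunion : 1 ≤ P.real A + P.real Aᶜ := by
    have := measureReal_union_le (μ := P) A Aᶜ
    rwa [Set.union_compl_self, probReal_univ] at this
  have hbad' : P.real Aᶜ ≤ 4 * Real.exp (-(τ ^ 2 / (2 * Real.pi)) * Real.log L) :=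
    ENNReal.toReal_le_of_le_ofReal (by positivity) hbad
  linarith
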